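/- Let $p$ be a prime and let $G$ be a Demushkin pro-$p$-group, i.e. a pro-$p$-group such that $\dim_{\mathbb F_p}H^1(G,\mathbb F_p)<\infty$, $\dim_{\mathbb F_p}H^2(G,\mathbb F_p)=1$, and the cup product $H^1(G,\mathbb F_p)\times H^1(G,\mathbb F_p)\to H^2(G,\mathbb F_p)$ is a non-degenerate bilinear form. Here cohomology is computed by inhomogeneous continuous cochains $C^\bullet(G,\mathbb F_p)$ with differential $\delta$, where $G$ acts trivially on the discrete module $\mathbb F_p$, so that $H^1(G,\mathbb F_p)=Z^1(G,\mathbb F_p)=\mathrm{Hom}_{\mathrm{cont}}(G,\mathbb F_p)$. Let $n\ge 3$ and $\chi_1,\dots,\chi_n\in H^1(G,\mathbb F_p)$. A complete defining system for $(\chi_1,\dots,\chi_n)$ is a family $(a_{ij})_{1\le i<j\le n+1}$ in $C^1(G,\mathbb F_p)$ such that $a_{i,i+1}=\chi_i$ for $1\le i\le n$ and $$\delta a_{ij}=\sum_{l=i+1}^{j-1}a_{il}\cup a_{lj}\qquad\text{whenever } i+1<j.$$ A defining system for the $n$-fold Massey product $\langle\chi_1,\dots,\chi_n\rangle$ is a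 family with the same properties in which the index pair $(1,n+1)$ is omitted; its value is the class in $H^2(G,\mathbb F_p)$ of the cocycle $\sum_{k=2}^{n}a_{1k}\cup a_{k,n+1}$. The Massey product is the set of the values of all its defining systems, and it is defined if it has a defining system. Then $\langle\chi_1,\dots,\chi_n\rangle$ is defined if and only if $$\chi_1\cup\chi_2=\chi_2\cup\chi_3=\cdots=\chi_{n-1}\cup\chi_n=0 .$$ Moreover, if these cup products vanish, then $(\chi_1,\dots,\chi_n)$ has a complete defining system, and $0\in\langle\chi_1,\dots,\chi_n\rangle$. -/

import Mathlib

set_option linter.unusedSectionVars false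

noncomputable section

namespace TrivialCoh

/-! Inhomogeneous continuous cochains, in degrees at most three, of a topological group `G` with
coefficients in the discrete trivial `G`-module `ZMod p`, with the usual differentials and
cup products. -/

variable (p : ℕ) (G : Type*) [Group G] [TopologicalSpace G]

/-- Continuous `1`-cochains. -/
abbrev C1 : Type _ := C(G, ZMod p)

/-- Continuous `2`-cochains. -/
abbrev C2 : Type _ := C(G × G, ZMod p)

/-- Continuous `3`-cochains. -/
abbrev C3 : Type _ := C(G × G × G, ZMod p)

variable [IsTopologicalGroup G]

/-- The differential on `1`-cochains: `(δ a)(g, h) = a h - a (g h) + a g`. -/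
def d1 : C1 p G →ₗ[ZMod p] C2 p G where
  toFun a := ⟨fun x => a x.2 - a (x.1 * x.2) + a x.1, by fun_prop⟩
  map_add' a b := by
    ext x
    simp only [ContinuousMap.coe_mk, ContinuousMap.add_apply]
    ring
  map_smul' c a := by
    ext x
    simp only [ContinuousMap.coe_mk, ContinuousMap.smul_apply, smul_eq_mul, RingHom.id_apply]
    ring

/-- The differential on `2`-cochains:
`(δ f)(g, h, k) = f (h, k) - f (g h, k) + f (g, h k) - f (g, h)`. -/
def d2 : C2 p G →ₗ[ZMod p] C3 p G where
  toFun f := ⟨fun x => f (x.2.1, x.2.2) - f (x.1 * x.2.1, x.2.2) + f (x.1, x.2.1 * x.2.2)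
    - f (x.1, x.2.1), by fun_prop⟩
  map_add' a b := by
    ext x
    simp only [ContinuousMap.coe_mk, ContinuousMap.add_apply]
    ring
  map_smul' c a := by
    ext x
    simp only [ContinuousMap.coe_mk, ContinuousMap.smul_apply, smul_eq_mul, RingHom.id_apply]
    ring

variable {p G}

@[simp]
theorem d1_apply (a : C1 p G) (g h : G) : d1 p G a (g, h) = a h - a (g * h) + a g := rfl

@[simp]
theorem d2_apply (f : C2 p G) (g h k : G) :
    d2 p G f (g, h, k) = f (h, k) - f (g * h, k) + f (g, h * k) - f (g, h) := rfl

theorem d2_d1 (a : C1 p G) : d2 p G (d1 p G a) = 0 := by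
  ext ⟨g, h, k⟩
  simp only [d2_apply, d1_apply, ContinuousMap.zero_apply, mul_assoc]
  ring

variable (p G)

/-- Continuous `1`-cocycles, that is, continuous homomorphisms from `G` to `ZMod p`. -/
def Z1 : Submodule (ZMod p) (C1 p G) := LinearMap.ker (d1 p G)

/-- The first cohomology group `H¹(G, 𝔽_p)`. Since the action of `G` on `ZMod p` is trivial, the
differential from degree zero to degree one vanishes, so that every cohomology class in degree one
consists of exactly one cocycle. -/
abbrev H1 : Type _ := Z1 p G

/-- Continuous `2`-cocycles. -/
def Z2 : Submodule (ZMod p) (C2 p G) := LinearMap.ker (d2 p G)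

/-- Continuous `2`-coboundaries, as a submodule of the `2`-cocycles. -/
def B2 : Submodule (ZMod p) (Z2 p G) := (LinearMap.range (d1 p G)).comap (Z2 p G).subtype

/-- The second cohomology group `H²(G, 𝔽_p)`. -/
abbrev H2 : Type _ := Z2 p G ⧸ B2 p G

variable {p G}

theorem mem_Z1_iff (a : C1 p G) : a ∈ Z1 p G ↔ ∀ g h : G, a (g * h) = a g + a h := by
  constructor
  · intro ha g h
    have := DFunLike.congr_fun (LinearMap.mem_ker.1 ha) (g, h)
    simp only [d1_apply, ContinuousMap.zero_apply] at this
    linear_combination -this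
  · intro ha
    refine LinearMap.mem_ker.2 ?_
    ext ⟨g, h⟩
    simp only [d1_apply, ContinuousMap.zero_apply, ha]
    ring

/-- The class in `H²(G, 𝔽_p)` of a `2`-cocycle. -/
def class2 (f : C2 p G) (hf : f ∈ Z2 p G) : H2 p G := Submodule.Quotient.mk ⟨f, hf⟩

/-- The cup product of two `1`-cochains: `(a ∪ b)(g, h) = a g * b h`. -/
def cupC (a b : C1 p G) : C2 p G := ⟨fun x => a x.1 * b x.2, by fun_prop⟩

@[simp]
theorem cupC_apply (a b : C1 p G) (g h : G) : cupC a b (g, h) = a g * b h := rfl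

theorem cupC_mem_Z2 {a b : C1 p G} (ha : a ∈ Z1 p G) (hb : b ∈ Z1 p G) :
    cupC a b ∈ Z2 p G := by
  rw [mem_Z1_iff] at ha hb
  refine LinearMap.mem_ker.2 ?_
  ext ⟨g, h, k⟩
  simp only [d2_apply, cupC_apply, ContinuousMap.zero_apply, ha, hb]
  ring

variable (p G)

/-- The cup product `H¹(G, 𝔽_p) × H¹(G, 𝔽_p) → H²(G, 𝔽_p)`. -/
def cup : H1 p G →ₗ[ZMod p] H1 p G →ₗ[ZMod p] H2 p G :=
  (LinearMap.mk₂ (ZMod p)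
    (fun a b : H1 p G => (⟨cupC a.1 b.1, cupC_mem_Z2 a.2 b.2⟩ : Z2 p G))
    (fun a a' b => by
      ext x
      exact add_mul (a.1 x.1) (a'.1 x.1) (b.1 x.2))
    (fun c a b => by
      ext x
      exact mul_assoc c (a.1 x.1) (b.1 x.2))
    (fun a b b' => by
      ext x
      exact mul_add (a.1 x.1) (b.1 x.2) (b'.1 x.2))
    (fun c a b => by
      ext x
      exact mul_left_comm (a.1 x.1) c (b.1 x.2))).compr₂ (B2 p G).mkQ

variable {p G}

theorem cup_apply (a b : H1 p G) :
    cup p G a b = class2 (cupC a.1 b.1) (cupC_mem_Z2 a.2 b.2) := rfl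

/-! Massey products. The index set `{1, …, n + 1}` is represented by `Fin (n + 1)`; only the entries
`a i j` with `i < j` (and `(i, j) ≠ (0, n)` for defining systems) matter. -/

/-- `a` is a defining system for the `n`-fold Massey product `⟨χ 0, …, χ (n - 1)⟩`. -/
structure IsDefiningSystem {n : ℕ} (χ : Fin n → H1 p G)
    (a : Fin (n + 1) → Fin (n + 1) → C1 p G) : Prop where
  diag : ∀ i : Fin n, a i.castSucc i.succ = (χ i : C1 p G)
  d_eq : ∀ i j : Fin (n + 1), (i : ℕ) + 1 < j → (i, j) ≠ (0, Fin.last n) →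
    d1 p G (a i j) = ∑ l ∈ Finset.Ioo i j, cupC (a i l) (a l j)

/-- `a` is a complete defining system for the tuple `(χ 0, …, χ (n - 1))`. -/
structure IsCompleteDefiningSystem {n : ℕ} (χ : Fin n → H1 p G)
    (a : Fin (n + 1) → Fin (n + 1) → C1 p G) : Prop where
  diag : ∀ i : Fin n, a i.castSucc i.succ = (χ i : C1 p G)
  d_eq : ∀ i j : Fin (n + 1), (i : ℕ) + 1 < j →
    d1 p G (a i j) = ∑ l ∈ Finset.Ioo i j, cupC (a i l) (a l j)

/-- The `n`-fold Massey product `⟨χ 0, …, χ (n - 1)⟩` is defined. -/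
def MasseyDefined {n : ℕ} (χ : Fin n → H1 p G) : Prop :=
  ∃ a : Fin (n + 1) → Fin (n + 1) → C1 p G, IsDefiningSystem χ a

/-- The `2`-cochain `∑ₖ a 0 k ∪ a k n` attached to a defining system. -/
def masseyCochain {n : ℕ} (a : Fin (n + 1) → Fin (n + 1) → C1 p G) : C2 p G :=
  ∑ k ∈ Finset.Ioo 0 (Fin.last n), cupC (a 0 k) (a k (Fin.last n))

theorem d2_cupC (a b : C1 p G) (g h k : G) :
    d2 p G (cupC a b) (g, h, k) = d1 p G a (g, h) * b k - a g * d1 p G b (h, k) := by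
  simp only [d2_apply, cupC_apply, d1_apply]
  ring

theorem IsDefiningSystem.d_eq' {n : ℕ} {χ : Fin n → H1 p G}
    {a : Fin (n + 1) → Fin (n + 1) → C1 p G} (ha : IsDefiningSystem χ a)
    {i j : Fin (n + 1)} (hij : i < j) (h : (i, j) ≠ (0, Fin.last n)) :
    d1 p G (a i j) = ∑ l ∈ Finset.Ioo i j, cupC (a i l) (a l j) := by
  rcases Nat.lt_or_ge ((i : ℕ) + 1) j with h1 | h1
  · exact ha.d_eq i j h1 h
  · have hlt : (i : ℕ) < j := hij
    have hjn : (j : ℕ) < n + 1 := j.2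
    obtain ⟨m, hmi, hmj⟩ : ∃ m : Fin n, i = m.castSucc ∧ j = m.succ :=
      ⟨⟨i, by omega⟩, rfl, Fin.ext (by simp only [Fin.val_succ]; omega)⟩
    have hempty : Finset.Ioo i j = ∅ := by
      ext l
      simp only [Finset.mem_Ioo, Fin.lt_def, Finset.notMem_empty, iff_false]
      omega
    rw [hempty, Finset.sum_empty, hmi, hmj, ha.diag m]
    exact LinearMap.mem_ker.1 (χ m).2

/-- The cochain attached to a defining system is a cocycle. -/
theorem IsDefiningSystem.mem_Z2 {n : ℕ} {χ : Fin n → H1 p G}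
    {a : Fin (n + 1) → Fin (n + 1) → C1 p G} (ha : IsDefiningSystem χ a) :
    masseyCochain a ∈ Z2 p G := by
  refine LinearMap.mem_ker.2 ?_
  ext ⟨g, h, k⟩
  have key : ∀ m ∈ Finset.Ioo 0 (Fin.last n),
      d2 p G (cupC (a 0 m) (a m (Fin.last n))) (g, h, k) =
        (∑ l ∈ Finset.Ioo 0 m, a 0 l g * a l m h * a m (Fin.last n) k) -
        ∑ l ∈ Finset.Ioo m (Fin.last n), a 0 m g * a m l h * a l (Fin.last n) k := by
    intro m hm
    rw [Finset.mem_Ioo] at hm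
    rw [d2_cupC, ha.d_eq' hm.1 (by simp [hm.2.ne]), ha.d_eq' hm.2 (by simp [hm.1.ne']),
      ContinuousMap.sum_apply, ContinuousMap.sum_apply, Finset.sum_mul, Finset.mul_sum]
    simp only [cupC_apply, mul_assoc]
  rw [masseyCochain, map_sum, ContinuousMap.sum_apply, Finset.sum_congr rfl key,
    Finset.sum_sub_distrib, ContinuousMap.zero_apply, sub_eq_zero]
  refine Finset.sum_comm' ?_
  intro x y
  simp only [Finset.mem_Ioo]
  constructor
  · rintro ⟨⟨_, h2⟩, h3, h4⟩
    exact ⟨⟨h4, h2⟩, h3, h4.trans h2⟩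
  · rintro ⟨⟨h1, h2⟩, h3, _⟩
    exact ⟨⟨h3.trans h1, h2⟩, h3, h1⟩

/-- The `n`-fold Massey product `⟨χ 0, …, χ (n - 1)⟩`, as the set of its values relative to all
defining systems. -/
def masseyProduct {n : ℕ} (χ : Fin n → H1 p G) : Set (H2 p G) :=
  {x | ∃ (a : Fin (n + 1) → Fin (n + 1) → C1 p G) (ha : IsDefiningSystem χ a),
    x = class2 (masseyCochain a) ha.mem_Z2}

variable (p G)

/-- `G` is a pro-`p`-group: a profinite group all of whose quotients by open normal subgroups
are (finite) `p`-groups. -/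
structure IsProP : Prop where
  compact : CompactSpace G
  totallyDisconnected : TotallyDisconnectedSpace G
  isPGroup : ∀ U : OpenNormalSubgroup G, IsPGroup p (G ⧸ U.toSubgroup)

/-- `G` is a Demushkin pro-`p`-group. -/
structure IsDemushkin : Prop where
  isProP : IsProP p G
  finite_H1 : Module.Finite (ZMod p) (H1 p G)
  finrank_H2 : Module.finrank (ZMod p) (H2 p G) = 1
  cup_nondegenerate : (cup p G).Nondegenerate

end TrivialCoh

end

namespace TrivialCoh

open Finset

variable {p : ℕ} {G : Type*} [Group G] [TopologicalSpace G] [IsTopologicalGroup G]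

/-! A complete system is built column by column, each new column from its diagonal entry upwards.
The obstruction to the entry in row `k` is the class of a cocycle. If `χ k ≠ 0`, non-degeneracy and
`dim H² = 1` make `χ k ∪ -` surjective onto `H²`, so adding a character to the entry just below
kills the obstruction; that entry's own equation, and those of the rows under it, are unaffected.
Only the diagonal entry is prescribed, and there the obstruction is a cup product of neighbours,
zero by hypothesis.

A vanishing character gives no such freedom. The induction therefore carries the condition that `a i
j = 0` whenever one of `χ i, …, χ (j - 1)` vanishes, which makes the obstruction zero termwise
(`IsSplitColumn.exists_extend`). -/

theorem class2_eq_zero_iff {f : C2 p G} (hf : f ∈ Z2 p G) :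
    class2 f hf = 0 ↔ ∃ c : C1 p G, d1 p G c = f := by
  rw [class2, Submodule.Quotient.mk_eq_zero]
  rfl

/-- A non-zero linear map into a one-dimensional space is onto. -/
theorem IsDemushkin.cup_surjective [Fact p.Prime] (hG : IsDemushkin p G) {x : H1 p G}
    (hx : x ≠ 0) : Function.Surjective (cup p G x) := by
  have h : cup p G x ≠ 0 := fun h => hx (hG.cup_nondegenerate.1 x fun y => by rw [h]; rfl)
  obtain ⟨y, hy⟩ : ∃ y, cup p G x y ≠ 0 := by
    by_contra! hc
    exact h (LinearMap.ext hc)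
  intro z
  obtain ⟨c, hc⟩ := (finrank_eq_one_iff_of_nonzero' _ hy).1 hG.finrank_H2 z
  exact ⟨c • y, by rw [map_smul, hc]⟩

/-- In a Demushkin group, every `2`-cocycle becomes a coboundary after adding the cup product of
a given non-zero character with a suitable one. -/
theorem IsDemushkin.exists_d1_eq_add_cupC [Fact p.Prime] (hG : IsDemushkin p G) {x : H1 p G}
    (hx : x ≠ 0) {f : C2 p G} (hf : f ∈ Z2 p G) :
    ∃ (y : H1 p G) (c : C1 p G), d1 p G c = f + cupC x.1 y.1 := by
  obtain ⟨y, hy⟩ := hG.cup_surjective hx (-class2 f hf)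
  have h0 : class2 (f + cupC x.1 y.1) (add_mem hf (cupC_mem_Z2 x.2 y.2)) = 0 := by
    have h1 : class2 f hf + cup p G x y = 0 := by rw [hy, add_neg_cancel]
    exact h1
  exact ⟨y, (class2_eq_zero_iff _).1 h0⟩

/-- `a` is a complete defining system for the first `N - 1` terms of the sequence `χ`, with
`a i j = 0` whenever one of `χ i, …, χ (j - 1)` vanishes. -/
structure IsSplitSystem (χ : ℕ → H1 p G) (N : ℕ) (a : ℕ → ℕ → C1 p G) : Prop where
  diag : ∀ i, i < N → a i (i + 1) = (χ i : C1 p G)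
  d_eq : ∀ i j, i < j → j ≤ N → d1 p G (a i j) = ∑ l ∈ Ioo i j, cupC (a i l) (a l j)
  eq_zero : ∀ i j m, i ≤ m → m < j → j ≤ N → χ m = 0 → a i j = 0

/-- The entries in rows `k, …, N` of a column extending the system `a` by one more column. -/
structure IsSplitColumn (χ : ℕ → H1 p G) (N : ℕ) (a : ℕ → ℕ → C1 p G) (k : ℕ)
    (b : ℕ → C1 p G) : Prop where
  diag : b N = (χ N : C1 p G)
  d_eq : ∀ i, k ≤ i → i ≤ N → d1 p G (b i) = ∑ l ∈ Ioc i N, cupC (a i l) (b l)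
  eq_zero : ∀ i m, k ≤ i → i ≤ m → m ≤ N → χ m = 0 → b i = 0

/-- By the Leibniz rule both halves of the differential become the same sum of triple products over
`k < l < m ≤ N`, with opposite signs. -/
theorem IsSplitColumn.sum_mem_Z2 {χ : ℕ → H1 p G} {N : ℕ} {a : ℕ → ℕ → C1 p G} {k : ℕ}
    {b : ℕ → C1 p G} (ha : IsSplitSystem χ N a) (hb : IsSplitColumn χ N a (k + 1) b) :
    ∑ l ∈ Ioc k N, cupC (a k l) (b l) ∈ Z2 p G := by
  refine LinearMap.mem_ker.2 ?_
  ext ⟨g, h, r⟩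
  have key : ∀ m ∈ Ioc k N, d2 p G (cupC (a k m) (b m)) (g, h, r) =
      (∑ l ∈ Ioo k m, a k l g * a l m h * b m r) -
        ∑ l ∈ Ioc m N, a k m g * a m l h * b l r := by
    intro m hm
    rw [mem_Ioc] at hm
    rw [d2_cupC, ha.d_eq k m hm.1 hm.2, hb.d_eq m hm.1 hm.2, ContinuousMap.sum_apply,
      ContinuousMap.sum_apply, sum_mul, mul_sum]
    simp only [cupC_apply, mul_assoc]
  rw [map_sum, ContinuousMap.sum_apply, sum_congr rfl key, sum_sub_distrib,
    ContinuousMap.zero_apply, sub_eq_zero]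
  refine sum_comm' fun x y => ?_
  simp only [mem_Ioc, mem_Ioo]
  omega

theorem IsSplitColumn.exists_extend [Fact p.Prime] (hG : IsDemushkin p G) {χ : ℕ → H1 p G}
    (hχ : ∀ i, cup p G (χ i) (χ (i + 1)) = 0) {N : ℕ} {a : ℕ → ℕ → C1 p G} {k : ℕ} (hk : k < N)
    {b : ℕ → C1 p G} (ha : IsSplitSystem χ N a) (hb : IsSplitColumn χ N a (k + 1) b) :
    ∃ b', IsSplitColumn χ N a k b' := by
  by_cases hz : ∃ m, k ≤ m ∧ m ≤ N ∧ χ m = 0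
  · obtain ⟨m, hkm, hmN, hm⟩ := hz
    have hupd : ∀ l, k < l → Function.update b k 0 l = b l := fun l hl =>
      Function.update_of_ne hl.ne' _ _
    refine ⟨Function.update b k 0, by rw [hupd N hk, hb.diag], fun i hi hiN => ?_,
      fun i r hi hir hrN hr => ?_⟩
    · rw [sum_congr rfl fun l hl => by rw [hupd l (hi.trans_lt (mem_Ioc.1 hl).1)]]
      rcases hi.eq_or_lt with rfl | hi
      · rw [Function.update_self, map_zero]
        refine (sum_eq_zero fun l hl => ?_).symm
        rw [mem_Ioc] at hl
        -- The zero character `χ m` lies in the range of the right factor if `l ≤ m`, and of the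
        -- left factor otherwise.
        rcases le_or_gt l m with hlm | hlm
        · rw [hb.eq_zero l m hl.1 hlm hmN hm]
          ext x
          exact mul_zero _
        · rw [ha.eq_zero k l m hkm hlm hl.2 hm]
          ext x
          exact zero_mul _
      · rw [hupd i hi, hb.d_eq i hi hiN]
    · rcases hi.eq_or_lt with rfl | hi
      · exact Function.update_self ..
      · rw [hupd i hi, hb.eq_zero i r hi hir hrN hr]
  · push Not at hz
    -- `y` is the correction to row `k + 1`; it must be zero when that row is the diagonal one,
    -- whose entry is fixed as `χ N`.
    obtain ⟨y, c, hy, hc⟩ : ∃ (y : H1 p G) (c : C1 p G), (k + 1 = N → y = 0) ∧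
        d1 p G c = ∑ l ∈ Ioc k N, cupC (a k l) (b l) + cupC (χ k : C1 p G) y.1 := by
      rcases eq_or_ne (k + 1) N with rfl | hkN
      · obtain ⟨c, hc⟩ := (class2_eq_zero_iff _).1 ((cup_apply _ _).symm.trans (hχ k))
        refine ⟨0, c, fun _ => rfl, ?_⟩
        rw [hc, Nat.Ioc_succ_singleton, sum_singleton, ha.diag k hk, hb.diag]
        ext x
        exact (add_eq_left.2 (mul_zero _)).symm
      · obtain ⟨y, c, hc⟩ := hG.exists_d1_eq_add_cupC (hz k le_rfl hk.le) (hb.sum_mem_Z2 ha)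
        exact ⟨y, c, fun h => absurd h hkN, hc⟩
    set b' : ℕ → C1 p G := Function.update (Function.update b (k + 1) (b (k + 1) + y.1)) k c
    have hb'k : b' k = c := Function.update_self ..
    have hb'k1 : b' (k + 1) = b (k + 1) + y.1 := by
      simp [b']
    have hb' : ∀ l, k + 1 < l → b' l = b l := fun l hl => by
      simp only [b', Function.update_of_ne hl.ne', Function.update_of_ne (by omega : l ≠ k)]
    refine ⟨b', ?_, fun i hi hiN => ?_, fun i m hi him hmN hm => absurd hm (hz m (hi.trans him) hmN)⟩
    · rcases eq_or_ne (k + 1) N with rfl | hkN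
      · rw [hb'k1, hy rfl, hb.diag]
        exact add_zero _
      · rw [hb' N (by omega), hb.diag]
    · rcases hi.eq_or_lt with rfl | hi
      · have hins : Ioc k N = insert (k + 1) (Ioc (k + 1) N) := by
          ext l
          simp only [mem_Ioc, mem_insert]
          omega
        have hnot : k + 1 ∉ Ioc (k + 1) N := by simp
        rw [hb'k, hc, hins, sum_insert hnot, sum_insert hnot, hb'k1, ha.diag k hk,
          ← sum_congr rfl fun l hl => by rw [← hb' l (mem_Ioc.1 hl).1], add_right_comm]
        congr 1
        ext x
        exact (mul_add ((χ k).1 x.1) (b (k + 1) x.2) (y.1 x.2)).symm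
      · rw [sum_congr rfl fun l hl => by
          rw [hb' l (lt_of_le_of_lt hi (mem_Ioc.1 hl).1)], ← hb.d_eq i hi hiN]
        -- Row `k + 1` keeps its equation because `y` is a cocycle and the right-hand side involves
        -- only lower rows.
        rcases Nat.eq_or_lt_of_le hi with rfl | hi
        · rw [hb'k1, map_add, LinearMap.mem_ker.1 y.2, add_zero]
        · rw [hb' i hi]

theorem IsSplitColumn.exists_column [Fact p.Prime] (hG : IsDemushkin p G) {χ : ℕ → H1 p G}
    (hχ : ∀ i, cup p G (χ i) (χ (i + 1)) = 0) {N : ℕ} {a : ℕ → ℕ → C1 p G}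
    (ha : IsSplitSystem χ N a) : ∃ b, IsSplitColumn χ N a 0 b := by
  refine Nat.decreasingInduction (motive := fun k _ => ∃ b, IsSplitColumn χ N a k b)
    (fun k hk ⟨b, hb⟩ => IsSplitColumn.exists_extend hG hχ hk ha hb) ?_ (Nat.zero_le N)
  refine ⟨fun _ => χ N, rfl, fun i hi hiN => ?_, fun i m hi him hmN hm => ?_⟩
  · obtain rfl := le_antisymm hi hiN
    rw [Ioc_self, sum_empty]
    exact LinearMap.mem_ker.1 (χ N).2
  · obtain rfl : m = N := by omega
    rw [hm]
    rfl

theorem IsSplitSystem.exists_of_cup_eq_zero [Fact p.Prime] (hG : IsDemushkin p G)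
    {χ : ℕ → H1 p G} (hχ : ∀ i, cup p G (χ i) (χ (i + 1)) = 0) (N : ℕ) :
    ∃ a, IsSplitSystem χ N a := by
  induction N with
  | zero =>
    exact ⟨0, fun i hi => absurd hi (by omega), fun i j _ _ => by omega,
      fun i j m _ _ _ => by omega⟩
  | succ N ih =>
    obtain ⟨a, ha⟩ := ih
    obtain ⟨b, hb⟩ := IsSplitColumn.exists_column hG hχ ha
    have hlt : ∀ i j, j ≤ N → (if j = N + 1 then b i else a i j) = a i j := fun i j hj =>
      if_neg (by omega)
    refine ⟨fun i j => if j = N + 1 then b i else a i j, fun i hi => ?_, fun i j hij hj => ?_,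
      fun i j m him hmj hj hm => ?_⟩
    · rcases Nat.lt_succ_iff_lt_or_eq.1 hi with hi | rfl
      · exact (hlt i (i + 1) hi).trans (ha.diag i hi)
      · simp only [if_true, hb.diag]
    · rcases Nat.le_succ_iff.1 hj with hj | rfl
      · simp only [hlt _ _ hj, ha.d_eq i j hij hj]
        refine sum_congr rfl fun l hl => ?_
        rw [hlt _ _ ((mem_Ioo.1 hl).2.le.trans hj)]
      · have hI : Ioo i (N + 1) = Ioc i N := by
          ext l
          simp only [mem_Ioc, mem_Ioo]
          omega
        simp only [Nat.succ_eq_add_one, if_true, hI, hb.d_eq i (Nat.zero_le i) (by omega)]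
        refine sum_congr rfl fun l hl => ?_
        rw [hlt _ _ (mem_Ioc.1 hl).2]
    · rcases Nat.le_succ_iff.1 hj with hj | rfl
      · exact (hlt i j hj).trans (ha.eq_zero i j m him hmj hj hm)
      · simp only [Nat.succ_eq_add_one, if_true]
        exact hb.eq_zero i m (Nat.zero_le i) him (by omega) hm

theorem IsDemushkin.exists_isCompleteDefiningSystem [Fact p.Prime] (hG : IsDemushkin p G) {n : ℕ}
    {χ : Fin n → H1 p G} (hχ : ∀ (i : ℕ) (hi : i + 1 < n),
      cup p G (χ ⟨i, Nat.lt_of_succ_lt hi⟩) (χ ⟨i + 1, hi⟩) = 0) :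
    ∃ a : Fin (n + 1) → Fin (n + 1) → C1 p G, IsCompleteDefiningSystem χ a := by
  -- Extending `χ` by zero keeps all neighbouring cup products zero.
  obtain ⟨a, ha⟩ := IsSplitSystem.exists_of_cup_eq_zero hG
    (χ := fun i => if hi : i < n then χ ⟨i, hi⟩ else 0) (fun i => by
      by_cases hi : i + 1 < n
      · simp only [dif_pos hi, dif_pos (Nat.lt_of_succ_lt hi), hχ i hi]
      · simp only [dif_neg hi, map_zero]) n
  refine ⟨fun i j => a i j, fun i => ?_, fun i j hij => ?_⟩
  · rw [Fin.val_castSucc, Fin.val_succ, ha.diag i i.2, dif_pos i.2]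
  · rw [ha.d_eq i j (by omega) (by omega), ← Fin.map_valEmbedding_Ioo, sum_map]
    rfl

theorem IsCompleteDefiningSystem.isDefiningSystem {n : ℕ} {χ : Fin n → H1 p G}
    {a : Fin (n + 1) → Fin (n + 1) → C1 p G} (ha : IsCompleteDefiningSystem χ a) :
    IsDefiningSystem χ a :=
  ⟨ha.diag, fun i j hij _ => ha.d_eq i j hij⟩

theorem IsCompleteDefiningSystem.zero_mem_masseyProduct {n : ℕ} (hn : 2 ≤ n) {χ : Fin n → H1 p G}
    {a : Fin (n + 1) → Fin (n + 1) → C1 p G} (ha : IsCompleteDefiningSystem χ a) :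
    0 ∈ masseyProduct χ :=
  ⟨a, ha.isDefiningSystem, ((class2_eq_zero_iff _).2 ⟨a 0 (Fin.last n),
    ha.d_eq 0 (Fin.last n) (by simp only [Fin.val_zero, Fin.val_last]; omega)⟩).symm⟩

/-- The entry two steps right of the diagonal bounds the cup product; as `n ≥ 3`, it is never the
omitted corner. -/
theorem MasseyDefined.cup_eq_zero {n : ℕ} (hn : 3 ≤ n) {χ : Fin n → H1 p G}
    (h : MasseyDefined χ) (i : ℕ) (hi : i + 1 < n) :
    cup p G (χ ⟨i, Nat.lt_of_succ_lt hi⟩) (χ ⟨i + 1, hi⟩) = 0 := by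
  obtain ⟨a, ha⟩ := h
  rw [cup_apply, class2_eq_zero_iff]
  refine ⟨a ⟨i, by omega⟩ ⟨i + 2, by omega⟩, ?_⟩
  have hI : Ioo (⟨i, by omega⟩ : Fin (n + 1)) ⟨i + 2, by omega⟩ = {⟨i + 1, by omega⟩} := by
    ext l
    simp only [mem_Ioo, Fin.lt_def, mem_singleton, Fin.ext_iff]
    omega
  have hne : ((⟨i, by omega⟩, ⟨i + 2, by omega⟩) : Fin (n + 1) × Fin (n + 1)) ≠
      (0, Fin.last n) := by
    simp only [ne_eq, Prod.mk.injEq, Fin.ext_iff, Fin.val_zero, Fin.val_last]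
    omega
  rw [ha.d_eq _ _ (by simp) hne, hI, sum_singleton]
  exact congrArg₂ cupC (ha.diag ⟨i, by omega⟩) (ha.diag ⟨i + 1, hi⟩)

end TrivialCoh

theorem mainTheorem3 (p : ℕ) [Fact p.Prime] (G : Type*) [Group G] [TopologicalSpace G]
    [IsTopologicalGroup G] (hG : TrivialCoh.IsDemushkin p G) (n : ℕ) (hn : 3 ≤ n)
    (χ : Fin n → TrivialCoh.H1 p G) :
    (TrivialCoh.MasseyDefined χ ↔
      ∀ (i : ℕ) (hi : i + 1 < n),
        TrivialCoh.cup p G (χ ⟨i, Nat.lt_of_succ_lt hi⟩) (χ ⟨i + 1, hi⟩) = 0) ∧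
    ((∀ (i : ℕ) (hi : i + 1 < n),
        TrivialCoh.cup p G (χ ⟨i, Nat.lt_of_succ_lt hi⟩) (χ ⟨i + 1, hi⟩) = 0) →
      (∃ a : Fin (n + 1) → Fin (n + 1) → TrivialCoh.C1 p G,
        TrivialCoh.IsCompleteDefiningSystem χ a) ∧
      0 ∈ TrivialCoh.masseyProduct χ) := by
  refine ⟨⟨fun h => h.cup_eq_zero hn, fun h => ?_⟩, fun h => ?_⟩
  · obtain ⟨a, ha⟩ := hG.exists_isCompleteDefiningSystem h
    exact ⟨a, ha.isDefiningSystem⟩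
  · obtain ⟨a, ha⟩ := hG.exists_isCompleteDefiningSystem h
    exact ⟨⟨a, ha⟩, ha.zero_mem_masseyProduct (by omega)⟩
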